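/- Let $G$ be a finite perfect group and let $C\subseteq G$ be a single conjugacy class that generates $G$. For $k\ge 0$ let $\gamma_1,\dots,\gamma_{2k}$ be free generators of $\pi_1(D^2\setminus[2k])$, where $\gamma_i$ winds once counterclockwise around the $i$-th puncture if $i$ is odd (a positive puncture) and once clockwise if $i$ is even (a negative puncture), chosen so that the boundary of the disk is represented by $\gamma_\infty=\gamma_{2k}^{-1}\gamma_{2k-1}\cdots\gamma_4^{-1}\gamma_3\gamma_2^{-1}\gamma_1$. Put \[ \hat R_k=\{f\colon\pi_1(D^2\setminus[2k])\to G \text{ a homomorphism} \mid f(\gamma_i)\in C \text{ for all } i,\ f(\gamma_\infty)=1\},\qquad R_k=\{f\in\hat R_k\mid f\text{ is onto}\}. \] Let $B(G,C)=(B(G)\sqcup L_CB(G)\times D^2)/\mathrm{ev}$ be the Brand space, where $L_CB(G)$ is the component of the free loop space of the classifying space $B(G)$ that consists of the loops representing $C$, and $L_CB(G)\times S^1$ is glued to $B(G)$ by evaluation. With the bar model of $B(G)$ and the action-groupoid model of $L_CB(G)$, its homology in degree $2$ is that of the complex \[ \mathbb Z[G^3]\oplus\mathbb Z[C\times G]\to\mathbb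 Z[G^2]\oplus\mathbb Z[C]\to\mathbb Z[G], \] whose differentials are the bar differentials on the first summands, $c\mapsto (c)$ on $\mathbb Z[C]$, and $(c,g)\mapsto \big((c|g)-(g|g^{-1}cg),\ [g^{-1}cg]-[c]\big)$ on $\mathbb Z[C\times G]$. The reduced Schur multiplier is the finite group $M(G,C)=H_2(B(G,C))_{\mathrm{tor}}$. Every $f\in\hat R_k$ factors through $\pi_1(S^2\setminus[2k])$ and extends over the punctures, by means of the attached disks, to a map $\phi\colon S^2\to B(G,C)$; its Schur invariant is $\mathrm{sch}(f)=\phi_*([S^2])\in M(G,C)$. Put $R_k^0=\{f\in R_k\mid \mathrm{sch}(f)=0\}$. Then \[ \lim_{k\to\infty}\frac{\#R_k}{(\#C)^{2k}}=\frac1{\#G}\qquad\text{and}\qquad \lim_{k\to\infty}\frac{\#R_k^0}{(\#C)^{2k}}=\frac1{\#G\cdot\#M(G,C)}. \] -/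

import Mathlib

open Filter Topology

namespace BranchedHom

/-! ### Homomorphisms with prescribed monodromy -/

section Homs

variable {G : Type*} [Group G]

/-- The `i`-th factor, with sign, of the boundary word: with the free generators of
`π₁(D² ∖ [2k])` numbered `γ₁, …, γ₂ₖ` and `γᵢ₊₁ = FreeGroup.of i`, this is `γᵢ₊₁` if the puncture is
positive (`i` even, counting from `0`) and `γᵢ₊₁⁻¹` if it is negative. -/
def letter (k : ℕ) (i : Fin (2 * k)) : FreeGroup (Fin (2 * k)) :=
  if Even (i : ℕ) then FreeGroup.of i else (FreeGroup.of i)⁻¹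

/-- The boundary word `γ_∞ = γ₂ₖ⁻¹ γ₂ₖ₋₁ ⋯ γ₄⁻¹ γ₃ γ₂⁻¹ γ₁`. -/
def gammaInf (k : ℕ) : FreeGroup (Fin (2 * k)) :=
  (List.ofFn (letter k)).reverse.prod

/-- `T_k(G, C)`: homomorphisms from the free group `π₁(D² ∖ [2k])` that send every `γᵢ` into `C`. -/
def T (k : ℕ) (C : Set G) : Set (FreeGroup (Fin (2 * k)) →* G) :=
  {f | ∀ i, f (FreeGroup.of i) ∈ C}

/-- `R̂_k(G, C)`: those elements of `T_k(G, C)` that kill the boundary. -/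
def Rhat (k : ℕ) (C : Set G) : Set (FreeGroup (Fin (2 * k)) →* G) :=
  {f | f ∈ T k C ∧ f (gammaInf k) = 1}

/-- `R_k(G, C)`: the surjective elements of `R̂_k(G, C)`. -/
def R (k : ℕ) (C : Set G) : Set (FreeGroup (Fin (2 * k)) →* G) :=
  {f | f ∈ Rhat k C ∧ Function.Surjective f}

/-- The initial subword `γ₂ₖ^± ⋯ γⱼ₊₁^±` of `γ_∞`, made of the letters with index at least `j`
(counting from `0`). -/
def initialWord (k j : ℕ) : FreeGroup (Fin (2 * k)) :=
  ((List.ofFn (letter k)).drop j).reverse.prod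

theorem initialWord_zero (k : ℕ) : initialWord k 0 = gammaInf k := rfl

theorem initialWord_end (k : ℕ) : initialWord k (2 * k) = 1 := by
  simp [initialWord, List.drop_eq_nil_of_le]

theorem initialWord_step (k : ℕ) (i : Fin (2 * k)) :
    initialWord k i = initialWord k (i + 1) * letter k i := by
  unfold initialWord
  rw [List.drop_eq_getElem_cons (by simp)]
  simp

end Homs

/-! ### The Brand space `B(G, C)`, its second homology, and the reduced Schur multiplier

`B(G, C) = (B(G) ⊔ L_C B(G) × D²) / ev`, where `L_C B(G)` is the component of the free loop space of
`B(G)` that consists of the loops in the conjugacy class `C`.  Model `B(G)` by the bar construction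
(one `n`-simplex `(g₁ | ⋯ | gₙ)` for every `n`-tuple in `G`) and `L_C B(G)` by the nerve of the
groupoid of `G` acting on `C` by conjugation (vertices `c ∈ C`, edges `(c, g)` from `c` to
`g⁻¹ c g`).  The gluing along `ev` turns an `n`-simplex of `L_C B(G)` times `D²` into an
`(n + 2)`-cell, so the chain groups of `B(G, C)` in degrees 1, 2 and 3 are

* `ℤ[G]`,
* `ℤ[G²] ⊕ ℤ[C]`        (a disk `D_c = {c} × D²` for every `c ∈ C`),
* `ℤ[G³] ⊕ ℤ[C × G]`    (a solid cylinder `(c, g) × D²` for every edge `(c, g)`). -/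

section Brand

variable {G : Type*} [Group G]

theorem conj_mem_carrier (C : ConjClasses G) (c : C.carrier) (g : G) :
    g⁻¹ * (c : G) * g ∈ C.carrier := by
  have hc := ConjClasses.mem_carrier_iff_mk_eq.1 c.2
  refine ConjClasses.mem_carrier_iff_mk_eq.2 (Eq.trans ?_ hc)
  exact ConjClasses.mk_eq_mk_iff_isConj.2 (isConj_iff.2 ⟨g⁻¹, by simp⟩ : IsConj (c : G) _).symm

/-- The conjugate `g⁻¹ c g`, as an element of the class `C`. -/
def conjBy {C : ConjClasses G} (c : C.carrier) (g : G) : C.carrier :=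
  ⟨g⁻¹ * (c : G) * g, conj_mem_carrier C c g⟩

variable (G) in
/-- The bar differential `ℤ[G²] → ℤ[G]`, `(g | h) ↦ (h) - (gh) + (g)`. -/
noncomputable def barD2 : (G × G →₀ ℤ) →ₗ[ℤ] (G →₀ ℤ) :=
  Finsupp.linearCombination ℤ fun p =>
    Finsupp.single p.2 1 - Finsupp.single (p.1 * p.2) 1 + Finsupp.single p.1 1

variable (G) in
/-- The bar differential `ℤ[G³] → ℤ[G²]`,
`(g | h | j) ↦ (h | j) - (gh | j) + (g | hj) - (g | h)`. -/
noncomputable def barD3 : (G × G × G →₀ ℤ) →ₗ[ℤ] (G × G →₀ ℤ) :=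
  Finsupp.linearCombination ℤ fun p =>
    Finsupp.single (p.2.1, p.2.2) 1 - Finsupp.single (p.1 * p.2.1, p.2.2) 1
      + Finsupp.single (p.1, p.2.1 * p.2.2) 1 - Finsupp.single (p.1, p.2.1) 1

theorem barD2_single (g h : G) (n : ℤ) :
    barD2 G (Finsupp.single (g, h) n)
      = Finsupp.single h n - Finsupp.single (g * h) n + Finsupp.single g n := by
  simp [barD2, smul_sub, smul_add]

theorem barD3_single (g h j : G) (n : ℤ) :
    barD3 G (Finsupp.single (g, h, j) n)
      = Finsupp.single (h, j) n - Finsupp.single (g * h, j) n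
        + Finsupp.single (g, h * j) n - Finsupp.single (g, h) n := by
  simp [barD3, smul_sub, smul_add]

/-- 2-chains of `B(G, C)`. -/
abbrev BrandChain2 (C : ConjClasses G) : Type _ := (G × G →₀ ℤ) × (C.carrier →₀ ℤ)

/-- 3-chains of `B(G, C)`. -/
abbrev BrandChain3 (C : ConjClasses G) : Type _ :=
  (G × G × G →₀ ℤ) × (C.carrier × G →₀ ℤ)

/-- The boundary of the disk `D_c` is the loop `(c)`. -/
noncomputable def diskBoundary (C : ConjClasses G) : (C.carrier →₀ ℤ) →ₗ[ℤ] (G →₀ ℤ) :=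
  Finsupp.lmapDomain ℤ ℤ Subtype.val

/-- The boundary of the solid cylinder over the edge `(c, g)` consists of its two end disks
`D_{g⁻¹cg}` and `-D_c`, and of the cylinder swept out by the loop `c` along `g`, which is the square
`(c | g) - (g | g⁻¹cg)`. -/
noncomputable def cylinderBoundary (C : ConjClasses G) :
    (C.carrier × G →₀ ℤ) →ₗ[ℤ] BrandChain2 C :=
  Finsupp.linearCombination ℤ fun p =>
    (Finsupp.single ((p.1 : G), p.2) 1 - Finsupp.single (p.2, (conjBy p.1 p.2 : G)) 1,
      Finsupp.single (conjBy p.1 p.2) 1 - Finsupp.single p.1 1)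

/-- The differential from 2-chains to 1-chains of `B(G, C)`. -/
noncomputable def brandD2 (C : ConjClasses G) : BrandChain2 C →ₗ[ℤ] (G →₀ ℤ) :=
  (barD2 G).coprod (diskBoundary C)

/-- The differential from 3-chains to 2-chains of `B(G, C)`. -/
noncomputable def brandD3 (C : ConjClasses G) : BrandChain3 C →ₗ[ℤ] BrandChain2 C :=
  (LinearMap.inl ℤ _ _ ∘ₗ barD3 G).coprod (cylinderBoundary C)

theorem brandD2_comp_brandD3 (C : ConjClasses G) : brandD2 C ∘ₗ brandD3 C = 0 := by
  apply LinearMap.prod_ext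
  · ext ⟨g, h, j⟩ : 2
    simp only [brandD2, brandD3, LinearMap.comp_apply, LinearMap.inl_apply,
      LinearMap.coprod_apply, Finsupp.lsingle_apply, barD3_single, map_sub, map_add, map_zero,
      barD2_single, mul_assoc, LinearMap.zero_apply, add_zero]
    abel_nf
  · ext ⟨c, g⟩ : 2
    simp only [brandD2, brandD3, cylinderBoundary, diskBoundary, barD2_single, LinearMap.comp_apply,
      LinearMap.inr_apply, Finsupp.lsingle_apply, LinearMap.coprod_apply, map_zero, zero_add,
      Finsupp.linearCombination_single, one_smul, map_sub, Finsupp.lmapDomain_apply,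
      Finsupp.mapDomain_single, LinearMap.zero_apply, conjBy, mul_assoc, mul_inv_cancel_left]
    abel

/-- `H₂(B(G, C))`: 2-cycles modulo boundaries of 3-chains. -/
noncomputable abbrev BrandH2 (C : ConjClasses G) : Type _ :=
  LinearMap.ker (brandD2 C) ⧸ (LinearMap.range (brandD3 C)).submoduleOf (LinearMap.ker (brandD2 C))

/-- The reduced Schur multiplier `M(G, C) = H₂(B(G, C))_tor`. -/
noncomputable abbrev reducedSchurMultiplier (C : ConjClasses G) : Submodule ℤ (BrandH2 C) :=
  Submodule.torsion ℤ (BrandH2 C)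

instance reducedSchurMultiplier_finite [Finite G] (C : ConjClasses G) :
    Finite (reducedSchurMultiplier C) :=
  Module.finite_of_fg_torsion _ Submodule.torsion_isTorsion

end Brand

/-! ### The Schur invariant -/

section Schur

variable {G : Type*} [Group G]

/-- The part of the fundamental 2-chain of the sphere that belongs to the puncture `i`, mapped to
`B(G, C)` by `f` with the punctures filled in by disks.  Write `c` for `f(γᵢ₊₁)` and `p` for the
image of the part of the boundary word before the letter `i`.  The sphere minus the open disks is
triangulated as a fan over the boundary word, whose triangle at this letter is `(p | c^{±1})`,
with negative orientation as its outer edge runs clockwise around the filled-in disk; the disk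
itself is `± D_c`.  At a negative puncture, `(c | c⁻¹)` and the degenerate `(1 | 1)` identify the
edge `c⁻¹` with the edge `c` run backwards. -/
noncomputable def punctureChain {k : ℕ} {C : ConjClasses G} (f : FreeGroup (Fin (2 * k)) →* G)
    (hf : f ∈ T k C.carrier) (i : Fin (2 * k)) : BrandChain2 C :=
  let c : C.carrier := ⟨f (FreeGroup.of i), hf i⟩
  let p : G := f (initialWord k (i + 1))
  if Even (i : ℕ) then
    (-Finsupp.single (p, (c : G)) 1, Finsupp.single c 1)
  else
    (-Finsupp.single (p, (c : G)⁻¹) 1 + Finsupp.single ((c : G), (c : G)⁻¹) 1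
        + Finsupp.single (1, 1) 1,
      -Finsupp.single c 1)

/-- The 2-chain in `B(G, C)` that is the image of the fundamental cycle of `S²`. -/
noncomputable def sphereChain {k : ℕ} {C : ConjClasses G} (f : FreeGroup (Fin (2 * k)) →* G)
    (hf : f ∈ T k C.carrier) : BrandChain2 C :=
  ∑ i, punctureChain f hf i

theorem brandD2_punctureChain {k : ℕ} {C : ConjClasses G} (f : FreeGroup (Fin (2 * k)) →* G)
    (hf : f ∈ T k C.carrier) (i : Fin (2 * k)) :
    brandD2 C (punctureChain f hf i)
      = Finsupp.single (f (initialWord k i)) 1 - Finsupp.single (f (initialWord k (i + 1))) 1 := by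
  rw [initialWord_step k i]
  by_cases hi : Even (i : ℕ)
  · simp [punctureChain, hi, brandD2, diskBoundary, letter, barD2_single]
    abel
  · simp only [punctureChain, hi, brandD2, diskBoundary, letter, barD2_single, if_false,
      LinearMap.coprod_apply, map_add, map_neg, Finsupp.lmapDomain_apply, Finsupp.mapDomain_single,
      map_mul, map_inv, mul_inv_cancel, mul_one]
    abel

theorem sphereChain_mem_ker {k : ℕ} {C : ConjClasses G} (f : FreeGroup (Fin (2 * k)) →* G)
    (hf : f ∈ Rhat k C.carrier) : sphereChain f hf.1 ∈ LinearMap.ker (brandD2 C) := by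
  rw [LinearMap.mem_ker, sphereChain, map_sum]
  simp only [brandD2_punctureChain]
  rw [Fin.sum_univ_eq_sum_range (fun j => (Finsupp.single (f (initialWord k j)) (1 : ℤ)
    - Finsupp.single (f (initialWord k (j + 1))) 1)), Finset.sum_range_sub', initialWord_end,
    initialWord_zero, hf.2, map_one, sub_self]

/-- `f_*[S²] ∈ H₂(B(G, C))`. -/
noncomputable def sphereClass {k : ℕ} {C : ConjClasses G} (f : FreeGroup (Fin (2 * k)) →* G)
    (hf : f ∈ Rhat k C.carrier) : BrandH2 C :=
  Submodule.Quotient.mk ⟨sphereChain f hf.1, sphereChain_mem_ker f hf⟩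

theorem card_smul_bar (G : Type*) [Group G] [Fintype G] (z : G × G →₀ ℤ) (hz : barD2 G z = 0) :
    ∃ y, barD3 G y = (Fintype.card G : ℤ) • z := by
  let s : (G × G →₀ ℤ) →ₗ[ℤ] (G × G × G →₀ ℤ) :=
    Finsupp.linearCombination ℤ fun p => ∑ x, Finsupp.single (x, p.1, p.2) 1
  let P : (G →₀ ℤ) →ₗ[ℤ] (G × G →₀ ℤ) :=
    Finsupp.linearCombination ℤ fun g => ∑ x, Finsupp.single (x, g) 1
  have key : barD3 G ∘ₗ s + P ∘ₗ barD2 G = (Fintype.card G : ℤ) • LinearMap.id := by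
    ext ⟨g, h⟩ : 2
    have e : ∑ x : G, (Finsupp.single (x * g, h) 1 : G × G →₀ ℤ) = ∑ x, Finsupp.single (x, h) 1 :=
      Fintype.sum_equiv (Equiv.mulRight g) _ _ fun _ => rfl
    simp only [s, P, LinearMap.add_apply, LinearMap.comp_apply, Finsupp.lsingle_apply,
      Finsupp.linearCombination_single, one_smul, map_sum, barD3_single, barD2_single, map_sub,
      map_add, Finset.sum_sub_distrib, Finset.sum_add_distrib, e, LinearMap.smul_apply,
      LinearMap.id_apply, Finset.sum_const, Finset.card_univ, natCast_zsmul]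
    abel
  refine ⟨s z, ?_⟩
  simpa [hz] using LinearMap.congr_fun key z

theorem exists_conjBy {C : ConjClasses G} (c c₀ : C.carrier) : ∃ g, conjBy c g = c₀ := by
  have h : ConjClasses.mk (c : G) = ConjClasses.mk (c₀ : G) :=
    (ConjClasses.mem_carrier_iff_mk_eq.1 c.2).trans (ConjClasses.mem_carrier_iff_mk_eq.1 c₀.2).symm
  obtain ⟨g, hg⟩ := isConj_iff.1 (ConjClasses.mk_eq_mk_iff_isConj.1 h)
  exact ⟨g⁻¹, Subtype.ext (by simpa [conjBy] using hg)⟩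

/-- A 2-cycle of `B(G, C)` in which the disks cancel in total represents a torsion class. -/
theorem mk_mem_torsion [Finite G] {C : ConjClasses G} (x : LinearMap.ker (brandD2 C))
    (hx : Finsupp.linearCombination ℤ (fun _ => (1 : ℤ)) (x : BrandChain2 C).2 = 0) :
    (Submodule.Quotient.mk x : BrandH2 C) ∈ reducedSchurMultiplier C := by
  cases nonempty_fintype G
  obtain ⟨c, hc⟩ := ConjClasses.exists_rep C
  let c₀ : C.carrier := ⟨c, ConjClasses.mem_carrier_iff_mk_eq.2 hc⟩
  choose t ht using fun c : C.carrier => exists_conjBy c c₀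
  let K : (C.carrier →₀ ℤ) →ₗ[ℤ] BrandChain3 C :=
    Finsupp.linearCombination ℤ fun c => (0, Finsupp.single (c, t c) 1)
  have hK : LinearMap.snd ℤ _ _ ∘ₗ brandD3 C ∘ₗ K + LinearMap.id
      = (Finsupp.lsingle c₀) ∘ₗ Finsupp.linearCombination ℤ (fun _ => (1 : ℤ)) := by
    ext c : 2
    simp [K, brandD3, cylinderBoundary, ht]
  have h2 : (brandD3 C (K (x : BrandChain2 C).2) + x).2 = 0 := by
    simpa [hx] using LinearMap.congr_fun hK (x : BrandChain2 C).2
  set u := brandD3 C (K (x : BrandChain2 C).2) + x with hu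
  have hD : brandD2 C u = 0 := by
    have h3 := LinearMap.congr_fun (brandD2_comp_brandD3 C) (K (x : BrandChain2 C).2)
    have h4 : brandD2 C x = 0 := x.2
    simp only [LinearMap.comp_apply, LinearMap.zero_apply] at h3
    rw [hu, map_add, h3, h4, add_zero]
  have hz : barD2 G u.1 = 0 := by
    simpa [brandD2, h2] using hD
  obtain ⟨y, hy⟩ := card_smul_bar G u.1 hz
  have hcard : (Fintype.card G : ℤ) ≠ 0 := by exact_mod_cast Fintype.card_ne_zero
  refine ⟨⟨(Fintype.card G : ℤ), mem_nonZeroDivisors_of_ne_zero hcard⟩, ?_⟩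
  change Submodule.Quotient.mk ((Fintype.card G : ℤ) • x) = 0
  rw [Submodule.Quotient.mk_eq_zero]
  refine ⟨(y, 0) - (Fintype.card G : ℤ) • K (x : BrandChain2 C).2, ?_⟩
  have h5 : brandD3 C (y, 0) = (Fintype.card G : ℤ) • u := by
    ext1
    · simp [brandD3, hy]
    · simp [brandD3, h2]
  rw [map_sub, map_smul, h5, hu, smul_add, add_sub_cancel_left]
  rfl

theorem sphereChain_disks {k : ℕ} {C : ConjClasses G} (f : FreeGroup (Fin (2 * k)) →* G)
    (hf : f ∈ T k C.carrier) :
    Finsupp.linearCombination ℤ (fun _ => (1 : ℤ)) (sphereChain f hf).2 = 0 := by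
  have h : ∀ i : Fin (2 * k), Finsupp.linearCombination ℤ (fun _ => (1 : ℤ))
      (punctureChain f hf i).2 = (-1) ^ (i : ℕ) := by
    intro i
    by_cases hi : Even (i : ℕ)
    · simp [punctureChain, hi]
    · simp [punctureChain, hi, (Nat.not_even_iff_odd.1 hi).neg_one_pow]
  rw [sphereChain, Prod.snd_sum, map_sum, Finset.sum_congr rfl fun i _ => h i,
    Fin.sum_univ_eq_sum_range (fun j => (-1 : ℤ) ^ j), neg_one_geom_sum]
  simp

/-- The Schur invariant `sch : R̂_k(G, C) → M(G, C)`, `sch(f) = f_*[S²]`. -/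
noncomputable def sch [Finite G] {k : ℕ} {C : ConjClasses G} (f : Rhat k C.carrier) :
    reducedSchurMultiplier C :=
  ⟨sphereClass f.1 f.2, mk_mem_torsion _ (sphereChain_disks f.1 f.2.1)⟩

/-- `R_k^0(G, C)`: the elements of `R_k(G, C)` whose Schur invariant vanishes. -/
def R0 [Finite G] (k : ℕ) (C : ConjClasses G) : Set (FreeGroup (Fin (2 * k)) →* G) :=
  {f | f ∈ R k C.carrier ∧ ∃ hf : f ∈ Rhat k C.carrier, sch ⟨f, hf⟩ = 0}

end Schur

end BranchedHom

namespace BranchedHom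

/-! ### Random walks on finite groups -/

section Walk

/-! A homomorphism sending every generator into `C` is a tuple of `2k` letters in `C`, and its
boundary value is an alternating word. Read two letters at a time, this word is a random walk whose
steps are the quotients `c⁻¹c'`. The quotients generate a normal subgroup with cyclic quotient,
hence all of `G` by perfectness. The step `c = c'` is trivial, so the walk is aperiodic and
equidistributes (`IsWalk.tendsto`): a random word is trivial with probability tending to `1/#G`.
Tuples that do not generate `G` have density tending to `0`.

For the Schur invariant the same walk is run in a central extension of `G` by the 2-chains of `B(G,
C)` modulo boundaries, with cocycle `(g | h)`. The letter `c` is lifted using the disk `D_c`, and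
the fibre coordinate of the lifted word records the image of the fundamental chain of the sphere.
Thus the word is trivial exactly when `f` kills the boundary and `sch f = 0`
(`alternatingWord_lift_eq_one_iff`). Quotients of lifts generate the subgroup `reduced`
(`liftQuotients_eq_reduced`), an extension of `G` by `M(G, C)` (`card_reduced`), so the limit is the
inverse of `#G · #M(G, C)`. -/

theorem tendsto_zero_of_antitone_of_contracting {u : ℕ → ℝ} (h0 : ∀ k, 0 ≤ u k)
    (hu : Antitone u) {L : ℕ} {r : ℝ} (hr : r < 1) (h : ∀ k, u (L + k) ≤ r * u k) :
    Tendsto u atTop (𝓝 0) := by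
  have hl := tendsto_atTop_ciInf hu ⟨0, by rintro _ ⟨k, rfl⟩; exact h0 k⟩
  set l := ⨅ k, u k
  have hl0 : 0 ≤ l := ge_of_tendsto' hl h0
  have h1 : Tendsto (fun k => u (L + k)) atTop (𝓝 l) := by
    simpa only [add_comm L] using (tendsto_add_atTop_iff_nat L).2 hl
  have h2 : l ≤ r * l := le_of_tendsto_of_tendsto' h1 (hl.const_mul r) h
  have h3 : l = 0 := by nlinarith
  rwa [h3] at hl

variable {N ι : Type*} [Group N] [Fintype N] [Fintype ι]

/-- `a k` is the distribution, after `k` steps, of the walk that starts at `1` and multiplies on the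
left by a uniformly chosen `s i`. -/
structure IsWalk (s : ι → N) (a : ℕ → N → ℝ) : Prop where
  zero_one : a 0 1 = 1
  zero_ne : ∀ n, n ≠ 1 → a 0 n = 0
  succ : ∀ k n, a (k + 1) n = (∑ i, a k ((s i)⁻¹ * n)) / Fintype.card ι

namespace IsWalk

variable {s : ι → N} {a : ℕ → N → ℝ}

omit [Fintype N] in
theorem nonneg (h : IsWalk s a) (k : ℕ) (n : N) : 0 ≤ a k n := by
  induction k generalizing n with
  | zero =>
    by_cases hn : n = 1
    · simp [hn, h.zero_one]
    · simp [h.zero_ne n hn]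
  | succ k ih =>
    rw [h.succ]
    exact div_nonneg (Finset.sum_nonneg fun i _ => ih _) (Nat.cast_nonneg _)

theorem sum_eq_one [Nonempty ι] (h : IsWalk s a) (k : ℕ) : ∑ n, a k n = 1 := by
  induction k with
  | zero => rw [Fintype.sum_eq_single 1 h.zero_ne, h.zero_one]
  | succ k ih =>
    have e : ∀ i, ∑ n, a k ((s i)⁻¹ * n) = 1 := fun i => by
      rw [← ih]
      exact Equiv.sum_comp (Equiv.mulLeft (s i)⁻¹) (a k)
    simp only [h.succ, ← Finset.sum_div]
    rw [Finset.sum_comm, Finset.sum_congr rfl fun i _ => e i]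
    simp

/-- Chapman–Kolmogorov: the position after `k + l` steps is a product of independent walks of
lengths `k` and `l`. -/
theorem add (h : IsWalk s a) (k l : ℕ) (n : N) :
    a (k + l) n = ∑ m, a k m * a l (m⁻¹ * n) := by
  induction k generalizing n with
  | zero =>
    rw [Fintype.sum_eq_single 1 fun m hm => by rw [h.zero_ne m hm, zero_mul], h.zero_one]
    simp
  | succ k ih =>
    have e : ∀ i, a (k + l) ((s i)⁻¹ * n) = ∑ m, a k ((s i)⁻¹ * m) * a l (m⁻¹ * n) := fun i => by
      rw [ih, ← Equiv.sum_comp (Equiv.mulLeft (s i)⁻¹)]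
      simp [mul_assoc]
    rw [add_right_comm, h.succ, Finset.sum_congr rfl fun i _ => e i, Finset.sum_comm,
      Finset.sum_div]
    refine Finset.sum_congr rfl fun m _ => ?_
    rw [h.succ, ← Finset.sum_mul]
    ring

theorem pos_add (h : IsWalk s a) {k l : ℕ} {m n : N} (hm : 0 < a k m) (hn : 0 < a l n) :
    0 < a (k + l) (m * n) := by
  rw [h.add]
  refine Finset.sum_pos' (fun x _ => mul_nonneg (h.nonneg _ _) (h.nonneg _ _))
    ⟨m, Finset.mem_univ _, ?_⟩
  simpa using mul_pos hm hn

omit [Fintype N] in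
theorem pos_one [Nonempty ι] (h : IsWalk s a) (i : ι) : 0 < a 1 (s i) := by
  rw [h.succ 0]
  refine div_pos (Finset.sum_pos' (fun x _ => h.nonneg _ _) ⟨i, Finset.mem_univ _, ?_⟩)
    (by exact_mod_cast Fintype.card_pos)
  simp [h.zero_one]

theorem exists_pos [Nonempty ι] (h : IsWalk s a) (hs : Subgroup.closure (Set.range s) = ⊤) (n : N) :
    ∃ k, 0 < a k n := by
  have hn : n ∈ Submonoid.closure (Set.range s) := by
    -- In a finite group inverses are positive powers, so the steps already generate as a monoid.
    rw [← Subgroup.closure_toSubmonoid_of_finite, hs]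
    trivial
  induction hn using Submonoid.closure_induction with
  | mem x hx =>
    obtain ⟨i, rfl⟩ := hx
    exact ⟨1, h.pos_one i⟩
  | one => exact ⟨0, by simp [h.zero_one]⟩
  | mul x y _ _ hx hy =>
    obtain ⟨k, hk⟩ := hx
    obtain ⟨l, hl⟩ := hy
    exact ⟨k + l, h.pos_add hk hl⟩

/-- A trivial step lets the walk wait, so an element reached once stays reachable at all later
times. The sum of the individual times is late enough for every element. -/
theorem exists_forall_pos [Nonempty ι] (h : IsWalk s a)
    (hs : Subgroup.closure (Set.range s) = ⊤) (h1 : ∃ i, s i = 1) : ∃ L, ∀ n, 0 < a L n := by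
  obtain ⟨i, hi⟩ := h1
  choose k hk using h.exists_pos hs
  refine ⟨∑ n, k n, fun n => ?_⟩
  have stay : ∀ l, 0 < a (k n + l) n := fun l => by
    induction l with
    | zero => exact hk n
    | succ l ih => simpa [hi, ← add_assoc] using h.pos_add ih (h.pos_one i)
  obtain ⟨l, hl⟩ := Nat.exists_eq_add_of_le
    (Finset.single_le_sum (fun m _ => Nat.zero_le (k m)) (Finset.mem_univ n))
  rw [hl]
  exact stay l

/-- Doeblin's argument: deviations from the uniform distribution sum to zero, so subtracting the
constant `ε` from the `L`-step kernel does not change its effect on them. What remains is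
nonnegative of total mass `1 - #N · ε`. -/
theorem norm_sub_uniform_le [Nonempty ι] (h : IsWalk s a) {L : ℕ} {ε : ℝ} (hε : ∀ n, ε ≤ a L n)
    (k : ℕ) :
    ‖fun n => a (L + k) n - 1 / Fintype.card N‖
      ≤ (1 - Fintype.card N * ε) * ‖fun n => a k n - 1 / Fintype.card N‖ := by
  have hN : (Fintype.card N : ℝ) ≠ 0 := by exact_mod_cast Fintype.card_ne_zero
  have hmass : ∑ m, (a L m - ε) = 1 - Fintype.card N * ε := by
    rw [Finset.sum_sub_distrib, h.sum_eq_one]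
    simp
  have hr : 0 ≤ 1 - Fintype.card N * ε :=
    hmass ▸ Finset.sum_nonneg fun m _ => sub_nonneg.2 (hε m)
  refine (pi_norm_le_iff_of_nonneg (mul_nonneg hr (norm_nonneg _))).2 fun n => ?_
  have hinv : ∑ m, a k (m⁻¹ * n) = 1 := by
    rw [← h.sum_eq_one k]
    exact ((Equiv.inv N).trans (Equiv.mulRight n)).sum_comp (a k)
  have e : a (L + k) n - 1 / Fintype.card N
      = ∑ m, (a L m - ε) * (a k (m⁻¹ * n) - 1 / Fintype.card N) := by
    have e' : ∑ m, (a L m - ε) * (a k (m⁻¹ * n) - 1 / Fintype.card N)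
        = ∑ m, a L m * a k (m⁻¹ * n) - ε * ∑ m, a k (m⁻¹ * n)
          - (∑ m, (a L m - ε)) * (1 / Fintype.card N) := by
      rw [Finset.mul_sum, Finset.sum_mul, ← Finset.sum_sub_distrib, ← Finset.sum_sub_distrib]
      exact Finset.sum_congr rfl fun m _ => by ring
    rw [e', hinv, hmass, ← h.add]
    field_simp
    ring
  rw [e, ← hmass, Finset.sum_mul]
  refine norm_sum_le_of_le _ fun m _ => ?_
  rw [norm_mul, Real.norm_of_nonneg (sub_nonneg.2 (hε m))]
  exact mul_le_mul_of_nonneg_left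
    (norm_le_pi_norm (fun n => a k n - 1 / (Fintype.card N : ℝ)) (m⁻¹ * n)) (sub_nonneg.2 (hε m))

theorem tendsto [Nonempty ι] (h : IsWalk s a) (hs : Subgroup.closure (Set.range s) = ⊤)
    (h1 : ∃ i, s i = 1) (n : N) :
    Tendsto (fun k => a k n) atTop (𝓝 (1 / Fintype.card N)) := by
  obtain ⟨L, hL⟩ := h.exists_forall_pos hs h1
  obtain ⟨m, hm⟩ := Finite.exists_min (a L)
  -- Strict contraction is known only over `L` steps at a time; the case `ε = 0` of the same
  -- estimate controls single steps.
  have hanti : Antitone fun k => ‖fun n => a k n - 1 / (Fintype.card N : ℝ)‖ :=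
    antitone_nat_of_succ_le fun k => by
      simpa [add_comm] using h.norm_sub_uniform_le (L := 1) (ε := 0) (h.nonneg 1) k
  have hr : 1 - Fintype.card N * a L m < 1 := by
    have : (0 : ℝ) < Fintype.card N := by exact_mod_cast Fintype.card_pos
    linarith [mul_pos this (hL m)]
  have hz := tendsto_zero_of_antitone_of_contracting (fun k => norm_nonneg _) hanti hr
    (h.norm_sub_uniform_le hm)
  have := squeeze_zero_norm
    (fun k => norm_le_pi_norm (fun n => a k n - 1 / (Fintype.card N : ℝ)) n) hz
  simpa using this.add_const (1 / (Fintype.card N : ℝ))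

end IsWalk

end Walk

/-! ### Alternating words -/

section Words

variable {H : Type*} [Group H]

/-- The word `⋯ w₃⁻¹ w₂ w₁⁻¹ w₀`. -/
def alternatingWord {m : ℕ} (w : Fin m → H) : H :=
  (List.ofFn fun i : Fin m => if Even (i : ℕ) then w i else (w i)⁻¹).reverse.prod

theorem alternatingWord_succ {m : ℕ} (w : Fin (m + 1) → H) :
    alternatingWord w = (if Even m then w (Fin.last m) else (w (Fin.last m))⁻¹)
      * alternatingWord fun i => w i.castSucc := by
  rw [alternatingWord, List.ofFn_succ']
  simp [alternatingWord]

theorem map_alternatingWord {H' : Type*} [Group H'] (φ : H →* H') {m : ℕ} (w : Fin m → H) :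
    φ (alternatingWord w) = alternatingWord fun i => φ (w i) := by
  rw [alternatingWord, map_list_prod, List.map_reverse, List.map_ofFn, alternatingWord]
  congr 3
  ext i
  by_cases hi : Even (i : ℕ) <;> simp [hi]

theorem gammaInf_eq_alternatingWord (k : ℕ) :
    gammaInf k = alternatingWord FreeGroup.of := rfl

variable {ι : Type*}

open Classical in
theorem sum_alternatingWord_succ [Fintype ι] (x : ι → H) (m : ℕ) (h : H) :
    (∑ w : Fin (m + 1) → ι, if alternatingWord (fun i => x (w i)) = h then (1 : ℝ) else 0)
      = ∑ c, ∑ w : Fin m → ι, if alternatingWord (fun i => x (w i))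
          = (if Even m then x c else (x c)⁻¹)⁻¹ * h then 1 else 0 := by
  rw [← (Fin.snocEquiv fun _ => ι).sum_comp, Fintype.sum_prod_type]
  simp [alternatingWord_succ, Fin.snocEquiv, eq_inv_mul_iff_mul_eq]

/-- The probability that an alternating word of length `2k` in random letters is trivial tends to
the inverse of the order of the group that is generated by the alternating words. -/
theorem tendsto_card_alternatingWord_eq_one [Finite ι] [Nonempty ι] (x : ι → H) (N : Subgroup H)
    [Finite N] (hN : Subgroup.closure (Set.range fun p : ι × ι => (x p.1)⁻¹ * x p.2) = N) :
    Tendsto (fun k : ℕ => ({w : Fin (2 * k) → ι | alternatingWord (fun i => x (w i)) = 1}.ncard : ℝ)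
      / (Nat.card ι : ℝ) ^ (2 * k)) atTop (𝓝 (1 / (Nat.card N : ℝ))) := by
  classical
  have := Fintype.ofFinite ι
  have := Fintype.ofFinite N
  have hι : (Fintype.card ι : ℝ) ≠ 0 := by exact_mod_cast Fintype.card_ne_zero
  let s : ι × ι → N := fun p => ⟨(x p.1)⁻¹ * x p.2, hN ▸ Subgroup.subset_closure ⟨p, rfl⟩⟩
  let a : ℕ → N → ℝ := fun k n =>
    (∑ w : Fin (2 * k) → ι, if alternatingWord (fun i => x (w i)) = n then (1 : ℝ) else 0)
      / (Fintype.card ι : ℝ) ^ (2 * k)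
  have ha : IsWalk s a := by
    refine ⟨?_, fun n hn => ?_, fun k n => ?_⟩
    · simp [a, alternatingWord]
    · have hn' : (1 : H) ≠ n := fun h => hn (Subtype.ext h.symm)
      simp [a, alternatingWord, hn']
    -- Splitting off the last two letters, of indices `2k + 1` (inverted) and `2k`, gives one step
    -- of the walk.
    · have h1 : ¬ Even (2 * k + 1) := by simp
      have h2 : Even (2 * k) := by simp
      change (∑ w : Fin (2 * k + 1 + 1) → ι,
        if alternatingWord (fun i => x (w i)) = (n : H) then (1 : ℝ) else 0)
          / (Fintype.card ι : ℝ) ^ (2 * k + 2) = _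
      rw [sum_alternatingWord_succ]
      simp only [sum_alternatingWord_succ, h1, h2, if_true, if_false]
      rw [Fintype.sum_prod_type]
      simp only [a, s, ← Finset.sum_div, Fintype.card_prod, Nat.cast_mul, Subgroup.coe_mul,
        Subgroup.coe_inv, mul_inv_rev, inv_inv, mul_assoc]
      field_simp
      ring
  have hs : Subgroup.closure (Set.range s) = ⊤ := by
    apply Subgroup.map_injective N.subtype_injective
    rw [MonoidHom.map_closure, ← Set.range_comp, ← MonoidHom.range_eq_map, Subgroup.range_subtype]
    exact hN
  inhabit ι
  -- A pair of equal letters supplies the trivial step.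
  have hlim := ha.tendsto hs ⟨(default, default), by simp [s]⟩ 1
  rw [Nat.card_eq_fintype_card, Nat.card_eq_fintype_card]
  refine hlim.congr fun k => ?_
  simp only [a, Finset.sum_boole, OneMemClass.coe_one]
  rw [← Set.ncard_coe_finset]
  simp

end Words

/-! ### Families that do not generate -/

section Generation

variable {G : Type*} [Group G]

/-- Union bound over the finitely many proper subgroups `K`: each misses some element of `C`, so the
proportion of tuples inside `K` decays geometrically. -/
theorem tendsto_ncard_not_generating [Finite G] (C : Set G) (hne : C.Nonempty)
    (hC : Subgroup.closure C = ⊤) :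
    Tendsto (fun k : ℕ => ({w : Fin (2 * k) → C |
        Subgroup.closure (Set.range fun i => (w i : G)) ≠ ⊤}.ncard : ℝ)
      / (C.ncard : ℝ) ^ (2 * k)) atTop (𝓝 0) := by
  classical
  have := Fintype.ofFinite G
  have := Fintype.ofFinite (Subgroup G)
  have := hne.to_subtype
  have hpos : (0 : ℝ) < Nat.card C := by exact_mod_cast Nat.card_pos
  let P : Finset (Subgroup G) := Finset.univ.filter (· ≠ ⊤)
  have hlim : Tendsto (fun k : ℕ => ∑ K ∈ P,
      ((Nat.card {c : C // (c : G) ∈ K} : ℝ) / Nat.card C) ^ (2 * k)) atTop (𝓝 0) := by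
    rw [← Finset.sum_const_zero (s := P)]
    refine tendsto_finsetSum _ fun K hK => ?_
    have hlt : (Nat.card {c : C // (c : G) ∈ K} : ℝ) / Nat.card C < 1 := by
      rw [div_lt_one hpos]
      norm_cast
      have : ∃ c : C, (c : G) ∉ K := by
        by_contra! hcon
        refine (Finset.mem_filter.1 hK).2 (top_le_iff.1 (hC ▸ ?_))
        exact (Subgroup.closure_le K).2 fun c hc => hcon ⟨c, hc⟩
      obtain ⟨c, hc⟩ := this
      rw [Nat.card_eq_fintype_card, Nat.card_eq_fintype_card]
      exact Fintype.card_subtype_lt hc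
    exact (tendsto_pow_atTop_nhds_zero_of_lt_one (by positivity) hlt).comp
      (tendsto_id.const_mul_atTop' two_pos)
  refine squeeze_zero (fun k => by positivity) (fun k => ?_) hlim
  simp only [div_pow, ← Finset.sum_div]
  rw [Nat.card_coe_set_eq]
  gcongr
  have hsub : {w : Fin (2 * k) → C | Subgroup.closure (Set.range fun i => (w i : G)) ≠ ⊤}
      ⊆ ⋃ K ∈ P, {w | ∀ i, (w i : G) ∈ K} := fun w hw => by
    simp only [Set.mem_iUnion]
    exact ⟨_, Finset.mem_filter.2 ⟨Finset.mem_univ _, hw⟩,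
      fun i => Subgroup.subset_closure ⟨i, rfl⟩⟩
  have hcard : ∀ K : Subgroup G, {w : Fin (2 * k) → C | ∀ i, (w i : G) ∈ K}.ncard
      = Nat.card {c : C // (c : G) ∈ K} ^ (2 * k) := fun K => by
    rw [← Nat.card_coe_set_eq]
    change Nat.card {w : Fin (2 * k) → C // ∀ i, (w i : G) ∈ K} = _
    rw [Nat.card_congr (Equiv.subtypePiEquivPi (p := fun (_ : Fin (2 * k)) (c : C) => (c : G) ∈ K)),
      Nat.card_fun]
    simp
  have hle := (Set.ncard_le_ncard hsub (Set.toFinite _)).trans (Finset.set_ncard_biUnion_le P _)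
  simp only [hcard] at hle
  exact_mod_cast hle

/-- Discarding the families that do not generate does not change the asymptotic density. -/
theorem tendsto_ncard_generating [Finite G] (C : Set G) (hne : C.Nonempty)
    (hC : Subgroup.closure C = ⊤) (A : ∀ k : ℕ, Set (Fin (2 * k) → C)) {l : ℝ}
    (hA : Tendsto (fun k : ℕ => ((A k).ncard : ℝ) / (C.ncard : ℝ) ^ (2 * k)) atTop (𝓝 l)) :
    Tendsto (fun k : ℕ => ({w | w ∈ A k ∧
        Subgroup.closure (Set.range fun i => (w i : G)) = ⊤}.ncard : ℝ)
      / (C.ncard : ℝ) ^ (2 * k)) atTop (𝓝 l) := by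
  have h0 := tendsto_ncard_not_generating C hne hC
  refine tendsto_of_tendsto_of_tendsto_of_le_of_le (by simpa using hA.sub h0) hA
    (fun k => ?_) (fun k => ?_)
  · simp only [← sub_div]
    gcongr
    rw [sub_le_iff_le_add]
    norm_cast
    refine (Set.ncard_le_ncard (t := _ ∪ _) (fun w hw => ?_) (Set.toFinite _)).trans
      (Set.ncard_union_le _ _)
    by_cases h : Subgroup.closure (Set.range fun i => (w i : G)) = ⊤
    · exact Or.inl ⟨hw, h⟩
    · exact Or.inr h
  · dsimp only
    gcongr
    · exact Set.toFinite _
    · exact fun w hw => hw.1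

end Generation

end BranchedHom

namespace BranchedHom

/-! ### The central extension of `G` by the 2-chains of `B(G, C)` modulo boundaries -/

section Extension

variable {G : Type*} [Group G]

/-- 2-chains of `B(G, C)` modulo boundaries. -/
abbrev BrandQuot (C : ConjClasses G) : Type _ := BrandChain2 C ⧸ LinearMap.range (brandD3 C)

variable (C : ConjClasses G)

/-- The universal 2-cocycle: the class of the 2-simplex `(g | h)`. -/
noncomputable def barClass (g h : G) : BrandQuot C :=
  Submodule.Quotient.mk (Finsupp.single (g, h) 1, 0)

/-- The class of the disk `D_c`. -/
noncomputable def diskClass (c : C.carrier) : BrandQuot C :=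
  Submodule.Quotient.mk (0, Finsupp.single c 1)

/-- This is the boundary of the 3-simplex `(g | h | j)`. -/
theorem barClass_cocycle (g h j : G) :
    barClass C h j + barClass C g (h * j) = barClass C (g * h) j + barClass C g h := by
  rw [← sub_eq_zero, ← (Submodule.Quotient.mk_eq_zero (LinearMap.range (brandD3 C))).2
    ⟨(Finsupp.single (g, h, j) 1, 0), rfl⟩]
  have e : brandD3 C (Finsupp.single (g, h, j) 1, 0)
      = ((Finsupp.single (h, j) 1, 0) + (Finsupp.single (g, h * j) 1, 0))
        - ((Finsupp.single (g * h, j) 1, 0) + (Finsupp.single (g, h) 1, 0)) := by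
    ext1
    · simp only [brandD3, LinearMap.coprod_apply, LinearMap.comp_apply, LinearMap.inl_apply,
        barD3_single, map_zero, add_zero, Prod.fst_sub, Prod.fst_add]
      abel
    · simp [brandD3]
  rw [e]
  rfl

/-- This is the boundary of the solid cylinder over `(c, g)`. -/
theorem barClass_sub_barClass (c : C.carrier) (g : G) :
    barClass C c g - barClass C g (conjBy c g) = diskClass C c - diskClass C (conjBy c g) := by
  rw [← sub_eq_zero, ← (Submodule.Quotient.mk_eq_zero (LinearMap.range (brandD3 C))).2
    ⟨(0, Finsupp.single (c, g) 1), rfl⟩]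
  have e : brandD3 C (0, Finsupp.single (c, g) 1)
      = ((Finsupp.single ((c : G), g) 1, 0) - (Finsupp.single (g, (conjBy c g : G)) 1, 0))
        - ((0, Finsupp.single c 1) - (0, Finsupp.single (conjBy c g) 1)) := by
    ext1
    · simp [brandD3, cylinderBoundary]
    · simp [brandD3, cylinderBoundary]
  rw [e]
  rfl

theorem barClass_one_left (g : G) : barClass C 1 g = barClass C 1 1 := by
  simpa using barClass_cocycle C 1 1 g

theorem barClass_one_right (g : G) : barClass C g 1 = barClass C 1 1 := by
  simpa using (barClass_cocycle C g 1 1).symm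

theorem barClass_inv_comm (g : G) : barClass C g⁻¹ g = barClass C g g⁻¹ := by
  have h := barClass_cocycle C g g⁻¹ g
  rw [inv_mul_cancel, mul_inv_cancel, barClass_one_left, barClass_one_right, add_comm] at h
  exact add_left_cancel h

/-- The central extension of `G` by `BrandQuot C` with cocycle `barClass C`. -/
@[ext]
structure BrandExt (C : ConjClasses G) where
  /-- the image in `G` -/
  base : G
  /-- the coordinate in the fibre -/
  fibre : BrandQuot C

namespace BrandExt

variable {C}

noncomputable instance : Mul (BrandExt C) :=
  ⟨fun x y => ⟨x.base * y.base, x.fibre + y.fibre + barClass C x.base y.base⟩⟩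

/-- The cocycle is not normalized, hence the shift by `(1 | 1)` here and in everything that follows.
-/
noncomputable instance : One (BrandExt C) := ⟨⟨1, -barClass C 1 1⟩⟩

noncomputable instance : Inv (BrandExt C) :=
  ⟨fun x => ⟨x.base⁻¹, -x.fibre - barClass C x.base x.base⁻¹ - barClass C 1 1⟩⟩

@[simp] theorem mul_base (x y : BrandExt C) : (x * y).base = x.base * y.base := rfl

@[simp] theorem mul_fibre (x y : BrandExt C) :
    (x * y).fibre = x.fibre + y.fibre + barClass C x.base y.base := rfl

@[simp] theorem one_base : (1 : BrandExt C).base = 1 := rfl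

@[simp] theorem one_fibre : (1 : BrandExt C).fibre = -barClass C 1 1 := rfl

@[simp] theorem inv_base (x : BrandExt C) : x⁻¹.base = x.base⁻¹ := rfl

@[simp] theorem inv_fibre (x : BrandExt C) :
    x⁻¹.fibre = -x.fibre - barClass C x.base x.base⁻¹ - barClass C 1 1 := rfl

noncomputable instance : Group (BrandExt C) :=
  Group.ofLeftAxioms
    (fun x y z => by
      ext
      · exact mul_assoc _ _ _
      · have h := barClass_cocycle C x.base y.base z.base
        rw [← sub_eq_zero] at h ⊢
        rw [← neg_eq_zero, ← h]
        simp only [mul_fibre, mul_base]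
        abel)
    (fun x => by
      ext
      · exact one_mul _
      · simp [barClass_one_left])
    (fun x => by
      ext
      · exact inv_mul_cancel _
      · simp only [mul_fibre, inv_fibre, inv_base, one_fibre, barClass_inv_comm]
        abel)

variable (C)

/-- The projection to `G`. -/
def proj : BrandExt C →* G where
  toFun := base
  map_one' := rfl
  map_mul' _ _ := rfl

@[simp] theorem proj_apply (x : BrandExt C) : proj C x = x.base := rfl

/-- The differential on 2-chains modulo boundaries. -/
noncomputable def boundary : BrandQuot C →ₗ[ℤ] (G →₀ ℤ) :=
  (LinearMap.range (brandD3 C)).liftQ (brandD2 C) (by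
    rintro _ ⟨y, rfl⟩
    exact LinearMap.congr_fun (brandD2_comp_brandD3 C) y)

/-- The algebraic number of disks in a 2-chain. -/
noncomputable def degree : BrandQuot C →ₗ[ℤ] ℤ :=
  (LinearMap.range (brandD3 C)).liftQ
    (Finsupp.linearCombination ℤ (fun _ => (1 : ℤ)) ∘ₗ LinearMap.snd ℤ _ _) (by
      rw [LinearMap.range_le_ker_iff]
      ext <;> simp [brandD3, cylinderBoundary])

@[simp] theorem boundary_mk (v : BrandChain2 C) :
    boundary C (Submodule.Quotient.mk v) = brandD2 C v := rfl

@[simp] theorem degree_mk (v : BrandChain2 C) :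
    degree C (Submodule.Quotient.mk v) = Finsupp.linearCombination ℤ (fun _ => (1 : ℤ)) v.2 := rfl

@[simp] theorem boundary_barClass (g h : G) : boundary C (barClass C g h)
    = Finsupp.single h 1 - Finsupp.single (g * h) 1 + Finsupp.single g 1 := by
  simp [barClass, brandD2, barD2_single]

@[simp] theorem boundary_diskClass (c : C.carrier) :
    boundary C (diskClass C c) = Finsupp.single (c : G) 1 := by
  simp [diskClass, brandD2, diskBoundary]

@[simp] theorem degree_barClass (g h : G) : degree C (barClass C g h) = 0 := by
  simp [barClass]

@[simp] theorem degree_diskClass (c : C.carrier) : degree C (diskClass C c) = 1 := by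
  simp [diskClass]

/-- The homomorphism from the extension to 1-chains that trivializes the boundary of the cocycle. -/
noncomputable def chainHom : BrandExt C →* Multiplicative (G →₀ ℤ) :=
  MonoidHom.mk' (fun x => Multiplicative.ofAdd (boundary C x.fibre + Finsupp.single x.base 1))
    fun x y => by
      rw [← ofAdd_add]
      refine congrArg Multiplicative.ofAdd ?_
      rw [mul_fibre, mul_base, map_add, map_add, boundary_barClass]
      abel

/-- The degree as a homomorphism on the extension. -/
noncomputable def degreeHom : BrandExt C →* Multiplicative ℤ :=
  MonoidHom.mk' (fun x => Multiplicative.ofAdd (degree C x.fibre)) fun x y => by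
    simp [← ofAdd_add]

/-- The elements without boundary and of degree `0`: the reduced Schur extension of `G`. -/
noncomputable def reduced : Subgroup (BrandExt C) := (chainHom C).ker ⊓ (degreeHom C).ker

variable {C}

theorem mem_reduced {x : BrandExt C} : x ∈ reduced C ↔
    boundary C x.fibre + Finsupp.single x.base 1 = 0 ∧ degree C x.fibre = 0 := Iff.rfl

/-- The lift of `c ∈ C` that is given by the disk `D_c`. -/
noncomputable def lift (c : C.carrier) : BrandExt C := ⟨c, -diskClass C c⟩

@[simp] theorem lift_base (c : C.carrier) : (lift c).base = c := rfl

@[simp] theorem lift_fibre (c : C.carrier) : (lift c).fibre = -diskClass C c := rfl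

/-- The solid cylinders are exactly the relations that make the lifts equivariant under conjugation,
so they form a single conjugacy class. -/
theorem lift_mul (c : C.carrier) (x : BrandExt C) :
    lift c * x = x * lift (conjBy c x.base) := by
  ext
  · simp [conjBy, mul_assoc]
  · have h := barClass_sub_barClass C c x.base
    rw [← sub_eq_zero] at h ⊢
    rw [← h]
    simp only [mul_fibre, lift_fibre, lift_base]
    abel

/-- `chainHom` kills each lift because `D_c` bounds `(c)`, and `degreeHom` takes the same value `-1`
on all of them. -/
theorem inv_lift_mul_lift_mem_reduced (c c' : C.carrier) : (lift c)⁻¹ * lift c' ∈ reduced C := by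
  have h : ∀ c : C.carrier, chainHom C (lift c) = 1 := fun c => by
    change Multiplicative.ofAdd _ = Multiplicative.ofAdd 0
    simp
  have h' : ∀ c : C.carrier, degreeHom C (lift c) = Multiplicative.ofAdd (-1) := fun c => by
    change Multiplicative.ofAdd _ = _
    simp
  exact ⟨by simp [h], by simp [h']⟩

theorem ker_proj_le_center : (proj C).ker ≤ Subgroup.center (BrandExt C) := fun z hz => by
  have hz' : z.base = 1 := hz
  refine Subgroup.mem_center_iff.2 fun x => ?_
  ext
  · simp [hz']
  · simp [hz', barClass_one_left, barClass_one_right, add_comm]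

/-- In the abelianization of the extension, the class of an element of the fibre is determined by
its boundary and its degree. -/
theorem reduced_le_commutator : reduced C ≤ commutator (BrandExt C) := fun x hx => by
  let π : BrandExt C → Additive (Abelianization (BrandExt C)) :=
    fun x => Additive.ofMul (Abelianization.of x)
  have hπ : ∀ x y, π (x * y) = π x + π y := fun x y => by simp [π]
  let u : BrandQuot C →ₗ[ℤ] Additive (Abelianization (BrandExt C)) :=
    (AddMonoidHom.mk' (fun a => π ⟨1, a - barClass C 1 1⟩) fun a b => by
      rw [← hπ]
      congr 1
      ext
      · simp
      · simp only [mul_fibre]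
        abel).toIntLinearMap
  let s : G → Additive (Abelianization (BrandExt C)) := fun g => π ⟨g, 0⟩
  have hsu : ∀ x, π x = s x.base + u x.fibre := fun x => by
    change _ = π _ + π _
    rw [← hπ]
    congr 1
    ext
    · simp
    · simp [barClass_one_right]
  obtain ⟨c, hc⟩ := ConjClasses.exists_rep C
  let c₀ : C.carrier := ⟨c, ConjClasses.mem_carrier_iff_mk_eq.2 hc⟩
  -- Conjugate elements agree in the abelianization.
  have hlift : ∀ c, π (lift c) = π (lift c₀) := fun c => by
    obtain ⟨g, hg⟩ := exists_conjBy c c₀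
    have h := congrArg π (lift_mul c ⟨g, 0⟩)
    rw [hπ, hπ, add_comm, hg] at h
    exact add_left_cancel h
  -- It suffices to check simplices and disks: the former give the multiplication rule for the
  -- section `s`, the latter the decomposition of `lift c`.
  have key : u = Finsupp.linearCombination ℤ s ∘ₗ boundary C
      - (LinearMap.toSpanSingleton ℤ _ (π (lift c₀))) ∘ₗ degree C := by
    apply Submodule.linearMap_qext
    apply LinearMap.prod_ext
    · ext ⟨g, h⟩ : 2
      change u (barClass C g h) = Finsupp.linearCombination ℤ s (boundary C (barClass C g h))
        - degree C (barClass C g h) • π (lift c₀)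
      have e : s g + s h = s (g * h) + u (barClass C g h) := by
        have e' := hsu (⟨g, 0⟩ * ⟨h, 0⟩)
        rw [hπ] at e'
        simpa using e'
      rw [eq_sub_of_add_eq' e.symm]
      simp only [boundary_barClass, degree_barClass, map_add, map_sub,
        Finsupp.linearCombination_single, one_smul, zero_smul]
      abel
    · ext c : 2
      change u (diskClass C c) = Finsupp.linearCombination ℤ s (boundary C (diskClass C c))
        - degree C (diskClass C c) • π (lift c₀)
      rw [← hlift c, hsu]
      simp
  have h := hsu x
  obtain ⟨h1, h2⟩ := mem_reduced.1 hx
  have h3 : s x.base = Finsupp.linearCombination ℤ s (Finsupp.single x.base 1) := by simp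
  rw [key, LinearMap.sub_apply, LinearMap.comp_apply, LinearMap.comp_apply, h2, map_zero, sub_zero,
    h3, ← map_add, add_comm, h1, map_zero] at h
  rw [← Abelianization.ker_of]
  exact h

variable (C) in
/-- The subgroup of the extension that is generated by the quotients of lifts. -/
noncomputable def liftQuotients : Subgroup (BrandExt C) :=
  Subgroup.closure (Set.range fun p : C.carrier × C.carrier => (lift p.1)⁻¹ * lift p.2)

-- The chain of inclusions `liftQuotients ≤ reduced ≤ commutator` closes up. Since `liftQuotients`
-- maps onto `G` and the kernel of `proj` is central, every element is a quotient product times a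
-- central one, and commutators ignore central factors.
open scoped commutatorElement in
theorem liftQuotients_eq_reduced (h : Subgroup.closure
    (Set.range fun p : C.carrier × C.carrier => (p.1 : G)⁻¹ * p.2) = ⊤) :
    liftQuotients C = reduced C := by
  refine le_antisymm ((Subgroup.closure_le _).2 ?_) (reduced_le_commutator.trans ?_)
  · rintro _ ⟨p, rfl⟩
    exact inv_lift_mul_lift_mem_reduced _ _
  have hmap : (liftQuotients C).map (proj C) = ⊤ := by
    rw [liftQuotients, MonoidHom.map_closure, ← Set.range_comp]
    exact h
  have hfac : ∀ x : BrandExt C, ∃ n ∈ liftQuotients C, ∃ z ∈ Subgroup.center (BrandExt C),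
      x = n * z := fun x => by
    obtain ⟨n, hn, hnx⟩ : proj C x ∈ (liftQuotients C).map (proj C) := hmap ▸ Subgroup.mem_top _
    exact ⟨n, hn, n⁻¹ * x, ker_proj_le_center (by rw [MonoidHom.mem_ker, map_mul, map_inv, hnx, inv_mul_cancel]), by simp⟩
  rw [commutator_def, Subgroup.commutator_le]
  intro x _ y _
  obtain ⟨n, hn, z, hz, rfl⟩ := hfac x
  obtain ⟨m, hm, w, hw, rfl⟩ := hfac y
  have e : ⁅n * z, m * w⁆ = ⁅n, m⁆ := by
    rw [Subgroup.mem_center_iff] at hz hw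
    have hz' : z * (m * w) * z⁻¹ = m * w := by rw [← hz, mul_inv_cancel_right]
    have hw' : w * n⁻¹ * w⁻¹ = n⁻¹ := by rw [← hw, mul_inv_cancel_right]
    calc ⁅n * z, m * w⁆ = n * (z * (m * w) * z⁻¹) * n⁻¹ * w⁻¹ * m⁻¹ := by
          simp only [commutatorElement_def, mul_inv_rev, mul_assoc]
      _ = n * m * (w * n⁻¹ * w⁻¹) * m⁻¹ := by rw [hz']; simp only [mul_assoc]
      _ = ⁅n, m⁆ := by rw [hw', commutatorElement_def]
  rw [e]
  exact (liftQuotients C).commutator_le_self (Subgroup.commutator_mem_commutator hn hm)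

/-! ### The order of the reduced extension -/

variable (C) in
/-- The inclusion of `H₂(B(G, C))` into 2-chains modulo boundaries. -/
noncomputable def ofH2 : BrandH2 C →ₗ[ℤ] BrandQuot C :=
  Submodule.mapQ _ _ (LinearMap.ker (brandD2 C)).subtype le_rfl

theorem ofH2_injective : Function.Injective (ofH2 C) := by
  rw [injective_iff_map_eq_zero]
  intro y hy
  obtain ⟨v, rfl⟩ := Submodule.Quotient.mk_surjective _ y
  have hv : (v : BrandChain2 C) ∈ LinearMap.range (brandD3 C) :=
    (Submodule.Quotient.mk_eq_zero _).1 hy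
  exact (Submodule.Quotient.mk_eq_zero _).2 hv

theorem boundary_ofH2 (y : BrandH2 C) : boundary C (ofH2 C y) = 0 := by
  obtain ⟨v, rfl⟩ := Submodule.Quotient.mk_surjective _ y
  exact v.2

theorem exists_ofH2_eq {a : BrandQuot C} (ha : boundary C a = 0) : ∃ y, ofH2 C y = a := by
  obtain ⟨v, rfl⟩ := Submodule.Quotient.mk_surjective _ a
  exact ⟨Submodule.Quotient.mk ⟨v, ha⟩, rfl⟩

/-- The degree takes values in the torsion-free group `ℤ`; the converse is `mk_mem_torsion`. -/
theorem mem_torsion_iff_degree_eq_zero [Finite G] (y : BrandH2 C) :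
    y ∈ reducedSchurMultiplier C ↔ degree C (ofH2 C y) = 0 := by
  constructor
  · rintro ⟨n, hn⟩
    have h : (n : ℤ) • degree C (ofH2 C y) = 0 := by
      rw [← map_smul, ← map_smul]
      change degree C (ofH2 C (n • y)) = 0
      rw [hn, map_zero, map_zero]
    exact (smul_eq_zero.1 h).resolve_left (nonZeroDivisors.coe_ne_zero n)
  · intro h
    obtain ⟨v, rfl⟩ := Submodule.Quotient.mk_surjective _ y
    exact mk_mem_torsion v h

theorem card_reduced [Finite G] (h : Subgroup.closure
    (Set.range fun p : C.carrier × C.carrier => (p.1 : G)⁻¹ * p.2) = ⊤) :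
    Nat.card (reduced C) = Nat.card G * Nat.card (reducedSchurMultiplier C) := by
  let p : reduced C →* G := (proj C).comp (reduced C).subtype
  have hp : Function.Surjective p := by
    rw [← MonoidHom.range_eq_top, MonoidHom.range_comp, Subgroup.range_subtype,
      ← liftQuotients_eq_reduced h, liftQuotients, MonoidHom.map_closure, ← Set.range_comp]
    exact h
  -- Over `1 ∈ G`, after the shift by `(1 | 1)`, the conditions defining `reduced` single out the
  -- cycles of degree `0`, that is, the torsion of `H₂`.
  have hker : Nat.card p.ker = Nat.card (reducedSchurMultiplier C) := by
    let F : reducedSchurMultiplier C → p.ker := fun y =>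
      ⟨⟨⟨1, ofH2 C y - barClass C 1 1⟩, by
        rw [mem_reduced]
        simpa [boundary_ofH2] using (mem_torsion_iff_degree_eq_zero (y : BrandH2 C)).1 y.2⟩, rfl⟩
    refine (Nat.card_congr (Equiv.ofBijective F ⟨fun y y' hy => ?_, fun x => ?_⟩)).symm
    · have := congrArg (fun x : p.ker => (x : BrandExt C).fibre) hy
      exact Subtype.ext (ofH2_injective (sub_left_injective this))
    · obtain ⟨⟨⟨g, a⟩, hx⟩, hg⟩ := x
      obtain rfl : g = 1 := hg
      obtain ⟨h1, h2⟩ := mem_reduced.1 hx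
      obtain ⟨y, hy⟩ := exists_ofH2_eq (C := C) (a := a + barClass C 1 1) (by simpa using h1)
      refine ⟨⟨y, (mem_torsion_iff_degree_eq_zero y).2 (by simpa [hy] using h2)⟩, ?_⟩
      ext
      · rfl
      · simp [F, hy]
  rw [Subgroup.card_eq_card_quotient_mul_card_subgroup p.ker, hker,
    Nat.card_congr (QuotientGroup.quotientKerEquivOfSurjective p hp).toEquiv]

theorem finite_reduced [Finite G] (h : Subgroup.closure
    (Set.range fun p : C.carrier × C.carrier => (p.1 : G)⁻¹ * p.2) = ⊤) : Finite (reduced C) :=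
  Nat.finite_of_card_ne_zero
    (by rw [card_reduced h]; exact (Nat.mul_pos Nat.card_pos Nat.card_pos).ne')

end BrandExt

end Extension

end BranchedHom

namespace BranchedHom

/-! ### Quotients of elements of a generating class -/

section Generation

variable {G : Type*} [Group G]

/-- The quotients of elements of a generating conjugacy class generate a perfect group. -/
theorem closure_inv_mul_eq_top (C : ConjClasses G) (hC : Subgroup.closure C.carrier = ⊤)
    (hG : commutator G = ⊤) :
    Subgroup.closure (Set.range fun p : C.carrier × C.carrier => (p.1 : G)⁻¹ * p.2) = ⊤ := by
  set N := Subgroup.closure (Set.range fun p : C.carrier × C.carrier => (p.1 : G)⁻¹ * p.2) with hN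
  have hmem : ∀ c c' : C.carrier, (c : G)⁻¹ * c' ∈ N := fun c c' =>
    Subgroup.subset_closure ⟨(c, c'), rfl⟩
  obtain ⟨z, hz⟩ := ConjClasses.exists_rep C
  let c₀ : C.carrier := ⟨z, ConjClasses.mem_carrier_iff_mk_eq.2 hz⟩
  -- Conjugation permutes `C`, hence the generators of `N`.
  have hnormal : N.Normal := by
    refine ⟨fun n hn g => ?_⟩
    induction hn using Subgroup.closure_induction with
    | mem x hx =>
      obtain ⟨⟨c, c'⟩, rfl⟩ := hx
      convert hmem (conjBy c g⁻¹) (conjBy c' g⁻¹) using 1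
      simp [conjBy, mul_assoc]
    | one => simp
    | mul x y _ _ hx hy => simpa [mul_assoc] using N.mul_mem hx hy
    | inv x _ hx => simpa [mul_assoc] using N.inv_mem hx
  -- All of `C` has the same image in `G ⧸ N`, and `C` generates `G`.
  have hcyc : ∀ x : G ⧸ N, x ∈ Subgroup.zpowers ((c₀ : G) : G ⧸ N) := by
    have h : (⊤ : Subgroup G) ≤ (Subgroup.zpowers ((c₀ : G) : G ⧸ N)).comap
        (QuotientGroup.mk' N) := by
      rw [← hC, Subgroup.closure_le]
      intro c hc
      have e : ((c₀ : G) : G ⧸ N) = (c : G ⧸ N) := QuotientGroup.eq.2 (hmem c₀ ⟨c, hc⟩)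
      change (c : G ⧸ N) ∈ Subgroup.zpowers ((c₀ : G) : G ⧸ N)
      rw [← e]
      exact Subgroup.mem_zpowers _
    intro x
    obtain ⟨g, rfl⟩ := QuotientGroup.mk_surjective x
    exact h (Subgroup.mem_top g)
  refine top_le_iff.1 (hG ▸ ?_)
  rw [commutator_def, Subgroup.commutator_le]
  intro x _ y _
  rw [← QuotientGroup.eq_one_iff]
  change QuotientGroup.mk' N _ = 1
  rw [map_commutatorElement, commutatorElement_eq_one_iff_mul_comm]
  obtain ⟨m, hm⟩ := Subgroup.mem_zpowers_iff.1 (hcyc (QuotientGroup.mk' N x))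
  obtain ⟨n, hn⟩ := Subgroup.mem_zpowers_iff.1 (hcyc (QuotientGroup.mk' N y))
  rw [← hm, ← hn]
  exact zpow_mul_comm _ _ _

end Generation

/-! ### The Schur invariant as an alternating word in the extension -/

section Schur

variable {G : Type*} [Group G] {C : ConjClasses G}

/-- Let `F` lift `f` to the extension. Each puncture chain is the difference of the fibre
coordinates of `F` at two consecutive initial words, so the sum over the fan telescopes. -/
theorem alternatingWord_lift {k : ℕ} (f : FreeGroup (Fin (2 * k)) →* G) (hf : f ∈ T k C.carrier) :
    alternatingWord (fun i => BrandExt.lift (⟨f (FreeGroup.of i), hf i⟩ : C.carrier))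
      = ⟨f (gammaInf k), -Submodule.Quotient.mk (sphereChain f hf) - barClass C 1 1⟩ := by
  let F : FreeGroup (Fin (2 * k)) →* BrandExt C :=
    FreeGroup.lift fun i => BrandExt.lift (⟨f (FreeGroup.of i), hf i⟩ : C.carrier)
  have hbase : ∀ x, (F x).base = f x := by
    refine DFunLike.congr_fun (f := (BrandExt.proj C).comp F) (g := f) ?_
    ext i
    simp [F]
  have hstep : ∀ i : Fin (2 * k), (Submodule.Quotient.mk (punctureChain f hf i) : BrandQuot C)
      = (F (initialWord k (i + 1))).fibre - (F (initialWord k i)).fibre := fun i => by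
    rw [initialWord_step k i, map_mul, BrandExt.mul_fibre, hbase, hbase]
    by_cases hi : Even (i : ℕ)
    · have e : (Submodule.Quotient.mk (punctureChain f hf i) : BrandQuot C)
          = -barClass C (f (initialWord k (i + 1))) (f (FreeGroup.of i))
            + diskClass C ⟨f (FreeGroup.of i), hf i⟩ := by
        rw [barClass, diskClass, ← Submodule.Quotient.mk_neg, ← Submodule.Quotient.mk_add]
        simp [punctureChain, hi]
      rw [e]
      simp only [letter, hi, if_true, F, FreeGroup.lift_apply_of, BrandExt.lift_fibre]
      abel
    -- At a negative puncture the extra simplices `(c | c⁻¹)` and `(1 | 1)` are the correction terms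
    -- in the formula for inverses.
    · have e : (Submodule.Quotient.mk (punctureChain f hf i) : BrandQuot C)
          = -barClass C (f (initialWord k (i + 1))) (f (FreeGroup.of i))⁻¹
            + barClass C (f (FreeGroup.of i)) (f (FreeGroup.of i))⁻¹ + barClass C 1 1
            - diskClass C ⟨f (FreeGroup.of i), hf i⟩ := by
        simp only [barClass, diskClass, ← Submodule.Quotient.mk_neg, ← Submodule.Quotient.mk_add,
          ← Submodule.Quotient.mk_sub]
        simp [punctureChain, hi]
      rw [e]
      simp only [letter, hi, if_false, F, map_inv, FreeGroup.lift_apply_of, BrandExt.lift_fibre,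
        BrandExt.lift_base, BrandExt.inv_fibre]
      abel
  have hsum : (Submodule.Quotient.mk (sphereChain f hf) : BrandQuot C)
      = -barClass C 1 1 - (F (gammaInf k)).fibre := by
    rw [sphereChain, ← Submodule.mkQ_apply, map_sum]
    simp only [Submodule.mkQ_apply, hstep]
    rw [Fin.sum_univ_eq_sum_range (fun j => (F (initialWord k (j + 1))).fibre
      - (F (initialWord k j)).fibre), Finset.sum_range_sub (fun j => (F (initialWord k j)).fibre),
      initialWord_end, initialWord_zero, map_one, BrandExt.one_fibre]
  have hF : alternatingWord (fun i => BrandExt.lift (⟨f (FreeGroup.of i), hf i⟩ : C.carrier))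
      = F (gammaInf k) := by
    rw [gammaInf_eq_alternatingWord, map_alternatingWord]
    simp [F]
  rw [hF]
  ext
  · exact hbase _
  · rw [hsum]
    abel_nf

theorem alternatingWord_lift_eq_one_iff [Finite G] {k : ℕ} (f : FreeGroup (Fin (2 * k)) →* G)
    (hf : f ∈ T k C.carrier) :
    alternatingWord (fun i => BrandExt.lift (⟨f (FreeGroup.of i), hf i⟩ : C.carrier)) = 1 ↔
      ∃ hf' : f ∈ Rhat k C.carrier, sch ⟨f, hf'⟩ = 0 := by
  rw [alternatingWord_lift, BrandExt.ext_iff]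
  have hfib : (-Submodule.Quotient.mk (sphereChain f hf) - barClass C 1 1 : BrandQuot C)
      = -barClass C 1 1 ↔ sphereChain f hf ∈ LinearMap.range (brandD3 C) := by
    rw [sub_eq_add_neg, add_eq_right, neg_eq_zero, Submodule.Quotient.mk_eq_zero]
  have hsch : ∀ hf' : f ∈ Rhat k C.carrier, sch ⟨f, hf'⟩ = 0 ↔
      sphereChain f hf ∈ LinearMap.range (brandD3 C) := fun hf' => by
    rw [← Subtype.coe_inj]
    exact Submodule.Quotient.mk_eq_zero _
  change f (gammaInf k) = 1 ∧ _ = -barClass C 1 1 ↔ _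
  rw [hfib]
  exact ⟨fun h => ⟨⟨hf, h.1⟩, (hsch _).2 h.2⟩, fun ⟨hf', h⟩ => ⟨hf'.2, (hsch _).1 h⟩⟩

/-- The homomorphism with prescribed values on the free generators. -/
def homOfTuple {C : Set G} (k : ℕ) (w : Fin (2 * k) → C) : FreeGroup (Fin (2 * k)) →* G :=
  FreeGroup.lift fun i => (w i : G)

@[simp] theorem homOfTuple_of {C : Set G} (k : ℕ) (w : Fin (2 * k) → C) (i : Fin (2 * k)) :
    homOfTuple k w (FreeGroup.of i) = w i := by
  simp [homOfTuple]

theorem homOfTuple_injective {C : Set G} (k : ℕ) :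
    Function.Injective (homOfTuple (C := C) k) := fun w w' h => by
  ext i
  simpa using DFunLike.congr_fun h (FreeGroup.of i)

theorem homOfTuple_mem_T {C : Set G} (k : ℕ) (w : Fin (2 * k) → C) : homOfTuple k w ∈ T k C :=
  fun i => by simp

theorem exists_homOfTuple_eq {C : Set G} {k : ℕ} {f : FreeGroup (Fin (2 * k)) →* G}
    (hf : f ∈ T k C) : ∃ w : Fin (2 * k) → C, homOfTuple k w = f :=
  ⟨fun i => ⟨f (FreeGroup.of i), hf i⟩, by ext; simp⟩

theorem surjective_homOfTuple_iff {C : Set G} (k : ℕ) (w : Fin (2 * k) → C) :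
    Function.Surjective (homOfTuple k w) ↔
      Subgroup.closure (Set.range fun i => (w i : G)) = ⊤ := by
  rw [← MonoidHom.range_eq_top, homOfTuple, FreeGroup.range_lift_eq_closure]

theorem R_eq_image {C : Set G} (k : ℕ) : R k C = homOfTuple k ''
    {w : Fin (2 * k) → C | w ∈ {w | alternatingWord (fun i => (w i : G)) = 1} ∧
      Subgroup.closure (Set.range fun i => (w i : G)) = ⊤} := by
  have hw : ∀ w : Fin (2 * k) → C,
      homOfTuple k w (gammaInf k) = alternatingWord fun i => (w i : G) := fun w => by
    rw [gammaInf_eq_alternatingWord, map_alternatingWord]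
    simp
  ext f
  constructor
  · rintro ⟨⟨hT, h1⟩, hs⟩
    obtain ⟨w, rfl⟩ := exists_homOfTuple_eq hT
    exact ⟨w, ⟨(hw w).symm.trans h1, (surjective_homOfTuple_iff k w).1 hs⟩, rfl⟩
  · rintro ⟨w, ⟨h1, hs⟩, rfl⟩
    exact ⟨⟨homOfTuple_mem_T k w, (hw w).trans h1⟩, (surjective_homOfTuple_iff k w).2 hs⟩

theorem R0_eq_image [Finite G] (k : ℕ) : R0 k C = homOfTuple k ''
    {w : Fin (2 * k) → C.carrier | w ∈ {w | alternatingWord (fun i => BrandExt.lift (w i)) = 1} ∧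
      Subgroup.closure (Set.range fun i => (w i : G)) = ⊤} := by
  have hw : ∀ w : Fin (2 * k) → C.carrier, alternatingWord (fun i => BrandExt.lift (w i)) = 1 ↔
      ∃ hf : homOfTuple k w ∈ Rhat k C.carrier, sch ⟨_, hf⟩ = 0 := fun w => by
    rw [← alternatingWord_lift_eq_one_iff _ (homOfTuple_mem_T k w)]
    simp
  ext f
  constructor
  · rintro ⟨⟨⟨hT, h1⟩, hs⟩, h0⟩
    obtain ⟨w, rfl⟩ := exists_homOfTuple_eq hT
    exact ⟨w, ⟨(hw w).2 h0, (surjective_homOfTuple_iff k w).1 hs⟩, rfl⟩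
  · rintro ⟨w, ⟨h1, hs⟩, rfl⟩
    obtain ⟨hf, h0⟩ := (hw w).1 h1
    exact ⟨⟨hf, (surjective_homOfTuple_iff k w).2 hs⟩, hf, h0⟩

end Schur

end BranchedHom

/-! ### The two limits -/

theorem lemmal {G : Type*} [Group G] [Finite G] (C : ConjClasses G)
    (hC : Subgroup.closure C.carrier = ⊤) (hG : commutator G = ⊤) :
    Tendsto (fun k : ℕ => ((BranchedHom.R k C.carrier).ncard : ℝ) / (C.carrier.ncard : ℝ) ^ (2 * k))
        atTop (𝓝 (1 / (Nat.card G : ℝ))) ∧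
      Tendsto (fun k : ℕ => ((BranchedHom.R0 k C).ncard : ℝ) / (C.carrier.ncard : ℝ) ^ (2 * k))
        atTop (𝓝 (1 / ((Nat.card G : ℝ) *
          (Nat.card (BranchedHom.reducedSchurMultiplier C) : ℝ)))) := by
  open BranchedHom in
  have hne : C.carrier.Nonempty := by
    obtain ⟨c, hc⟩ := ConjClasses.exists_rep C
    exact ⟨c, ConjClasses.mem_carrier_iff_mk_eq.2 hc⟩
  have := hne.to_subtype
  have hgen := closure_inv_mul_eq_top C hC hG
  have := BrandExt.finite_reduced hgen
  constructor
  · simp only [R_eq_image, Set.ncard_image_of_injective _ (homOfTuple_injective _)]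
    apply tendsto_ncard_generating _ hne hC
    simpa [Nat.card_coe_set_eq] using
      tendsto_card_alternatingWord_eq_one (fun c : C.carrier => (c : G)) ⊤ hgen
  · simp only [R0_eq_image, Set.ncard_image_of_injective _ (homOfTuple_injective _)]
    apply tendsto_ncard_generating _ hne hC
    -- The extension is infinite, but the walk stays in its finite subgroup `reduced`.
    have h := tendsto_card_alternatingWord_eq_one (BrandExt.lift (C := C)) (BrandExt.reduced C)
      (BrandExt.liftQuotients_eq_reduced hgen)
    rw [BrandExt.card_reduced hgen, Nat.cast_mul] at h
    simpa [Nat.card_coe_set_eq] using h
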